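/- Let $L\ge 1$ be an integer and let $P_0,N_0,R_c>0$; put $\gamma_0=P_0/N_0$. Let $h_1,\dots,h_L$ be independent complex random variables with law $\mathcal{CN}(0,1)$ (independent real and imaginary parts, each centred Gaussian of variance $1/2$). A signal $s$ of mean power $P_0$ is received on $L$ branches as $y_l=h_l s+z_l$, where the noises $z_l$ are independent, centred, of variance $N_0$, and the branches are combined to $\sum_l \overline{h_l}\,y_l$ (maximal ratio combining). Let $\gamma$ be the resulting signal-to-noise ratio given the channel, $\gamma=\dfrac{\left|\sum_l\overline{h_l}h_l\right|^2P_0}{\sum_l|\overline{h_l}|^2N_0}$ (read as $0$ when all $h_l=0$). For $x\in\mathbb R$ and $g>0$ let $$Q(x)=\frac1{\sqrt{2\pi}}\int_x^\infty e^{-t^2/2}\,dt,\quad C(g)=\log_2(1+g),\quad V(g)=\frac{g(2+g)}{(1+g)^2}(\log_2 e)^2,\quad p_\gamma(g)=\frac{(g/\gamma_0)^{L-1}e^{-g/\gamma_0}}{\gamma_0\,\Gamma(L)}.$$ Then: 1. $\gamma=\gamma_0\sum_l|h_l|^2$, and $\gamma$ has the Erlang distribution $\mathrm{Erlang}(L,1/\gamma_0)$,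 that is, density $p_\gamma$ on $(0,\infty)$. 2. For every blocklength $N\in\mathbb N$ the average packet loss probability is well defined and $$\overline{\varepsilon_p}(N):=\mathbb E\left[Q\left(\sqrt{\tfrac{N}{V(\gamma)}}\,(C(\gamma)-R_c)\right)\right]=\int_0^\infty Q\left(\sqrt{\tfrac{N}{V(g)}}\,(C(g)-R_c)\right)p_\gamma(g)\,dg .$$ 3. As $N\to\infty$, with $L$, $\gamma_0$ and $R_c$ fixed, $$\overline{\varepsilon_p}(N)=\left[1-\frac{1}{\Gamma(L)}\,\Gamma\left(L,\frac{2^{R_c}-1}{\gamma_0}\right)\right]\left(1+O\left(\frac1N\right)\right),$$ where $\Gamma(s,x)=\int_x^\infty t^{s-1}e^{-t}\,dt$ is the upper incomplete Gamma function. -/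

import Mathlib

open MeasureTheory ProbabilityTheory Filter Asymptotics Set

noncomputable section

namespace ShortPacket

/-- The Gaussian Q-function `Q(x) = (1/√(2π)) ∫_x^∞ exp(-t²/2) dt`. -/
def gaussQ (x : ℝ) : ℝ :=
  1 / Real.sqrt (2 * Real.pi) * ∫ t in Ioi x, Real.exp (-t ^ 2 / 2)

/-- The Shannon capacity `C(γ) = log₂(1+γ)`. -/
def capacity (γ : ℝ) : ℝ := Real.logb 2 (1 + γ)

/-- The channel dispersion `V(γ) = γ(2+γ)/(1+γ)² (log₂ e)²`. -/
def dispersion (γ : ℝ) : ℝ :=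
  γ * (2 + γ) / (1 + γ) ^ 2 * Real.logb 2 (Real.exp 1) ^ 2

/-- The finite-blocklength packet loss probability `Q(√(N/V(γ)) (C(γ) - R_c))` of a packet of
`N` channel uses with coding rate `Rc` received at signal-to-noise ratio `γ`. -/
def packetLoss (N : ℕ) (Rc γ : ℝ) : ℝ :=
  gaussQ (Real.sqrt (N / dispersion γ) * (capacity γ - Rc))

/-- The standard circularly symmetric complex Gaussian law `CN(0,1)`: the real and imaginary
parts are independent centred real Gaussians of variance `1/2`. -/
def stdComplexGaussian : Measure ℂ :=
  ((gaussianReal 0 (1 / 2)).prod (gaussianReal 0 (1 / 2))).map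
    Complex.measurableEquivRealProd.symm

/-- The signal-to-noise ratio after combining the branches `y_l = h_l s + z_l` with the maximal
ratio weights, giving `∑ conj(h_l) y_l = (∑ conj(h_l) h_l) s + ∑ conj(h_l) z_l`. Here `s` has
mean power `P₀` and the `z_l` are independent, centred, each of variance `N₀`: the numerator is
the mean power of the signal part, the denominator that of the noise part. -/
def mrcSNR {L : ℕ} (P₀ N₀ : ℝ) (h : Fin L → ℂ) : ℝ :=
  (‖∑ l, starRingEnd ℂ (h l) * h l‖ ^ 2 * P₀) / (∑ l, ‖starRingEnd ℂ (h l)‖ ^ 2 * N₀)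

/-- The density on `(0,∞)` of the Erlang distribution with shape `L` and rate `1/γ₀`. -/
def erlangPDF (L : ℕ) (γ₀ γ : ℝ) : ℝ :=
  (γ / γ₀) ^ (L - 1) * Real.exp (-(γ / γ₀)) / (γ₀ * Real.Gamma L)

/-- The packet loss probability averaged over the Erlang density of the SNR. -/
def avgPacketLoss (L : ℕ) (γ₀ Rc : ℝ) (N : ℕ) : ℝ :=
  ∫ γ in Ioi (0 : ℝ), packetLoss N Rc γ * erlangPDF L γ₀ γ

/-- The upper incomplete Gamma function `Γ(s,x) = ∫_x^∞ t^(s-1) exp(-t) dt`. -/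
def upperGamma (s x : ℝ) : ℝ := ∫ t in Ioi x, t ^ (s - 1) * Real.exp (-t)

end ShortPacket

end

/-! ### Law of the combined SNR, by characteristic functions -/

namespace ShortPacket

/-! The SNR is `γ₀` times a sum of independent squared moduli. Each summand has characteristic
function `1 / (1 - i t γ₀)`, and the `L`-th power of this is the transform of the Erlang density
(`hasLaw_sum_normSq`). Averaging the bounded measurable packet loss is then integration against that
density.

For the asymptotics, the loss is `Q (√N F)` with `F = margin x₀`, which has a simple zero at the
threshold `x₀ = 2 ^ Rc - 1`, is negative below and positive above. Replacing `Q` by its limiting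
step gives the Erlang mass of `(0, x₀]`, the bracket of the claim. The error is the integral of
`gaussDev (√N F)` against the density. It concentrates on a window of width `N ^ (-1/2)` about `x₀`,
so size alone gives only `O(N ^ (-1/2))`. The gain comes from oddness of `gaussDev`: with `F`
replaced by its tangent and the density by its value at `x₀`, the integral over a symmetric window
vanishes. The remainder is at most a multiple of `|u| exp (-b N u²)`, `u = x - x₀`, whose integral
is `O(1/N)`. Away from `x₀`, `|F|` is bounded below and the Gaussian tail is smaller still
(`exists_abs_integral_gaussDev_le`). The main term is positive, so the error is also relative. -/

lemma integrableOn_pow_mul_exp_neg_mul (n : ℕ) {r : ℝ} (hr : 0 < r) :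
    IntegrableOn (fun x : ℝ => x ^ n * Real.exp (-(r * x))) (Ioi 0) := by
  have h := integrableOn_rpow_mul_exp_neg_mul_rpow (s := n) (p := 1) (b := r)
    (by have : (0 : ℝ) ≤ n := n.cast_nonneg
        linarith) one_pos hr
  refine h.congr_fun (fun x _ => ?_) measurableSet_Ioi
  simp [Real.rpow_natCast]

lemma integrableOn_pow_mul_cexp_neg_mul (n : ℕ) {r : ℂ} (hr : 0 < r.re) :
    IntegrableOn (fun x : ℝ => (x : ℂ) ^ n * Complex.exp (-(r * x))) (Ioi 0) := by
  refine Integrable.mono' (integrableOn_pow_mul_exp_neg_mul n hr)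
    (by fun_prop) ?_
  filter_upwards [ae_restrict_mem measurableSet_Ioi] with x hx
  have hx : (0 : ℝ) < x := hx
  simp [Complex.norm_exp, abs_of_pos hx]

lemma tendsto_pow_mul_cexp_neg_mul (n : ℕ) {r : ℂ} (hr : 0 < r.re) :
    Tendsto (fun x : ℝ => (x : ℂ) ^ n * Complex.exp (-(r * x))) atTop (nhds 0) := by
  rw [tendsto_zero_iff_norm_tendsto_zero]
  refine (tendsto_rpow_mul_exp_neg_mul_atTop_nhds_zero n r.re hr).congr' ?_
  filter_upwards [eventually_gt_atTop 0] with x hx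
  simp [Complex.norm_exp, abs_of_pos hx, Real.rpow_natCast]

/-- The moments of an exponential function with complex rate. -/
lemma integral_pow_mul_cexp_neg_mul (n : ℕ) {r : ℂ} (hr : 0 < r.re) :
    ∫ x in Ioi (0 : ℝ), (x : ℂ) ^ n * Complex.exp (-(r * x)) = n.factorial / r ^ (n + 1) := by
  have hr0 : r ≠ 0 := by rintro rfl; simp at hr
  have hexp : ∀ x : ℝ, HasDerivAt (fun x : ℝ => Complex.exp (-(r * x)))
      (Complex.exp (-(r * x)) * -(r * 1)) x := fun x =>
    (((hasDerivAt_id x).ofReal_comp).const_mul r).neg.cexp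
  induction n with
  | zero =>
    have h := integral_Ioi_of_hasDerivAt_of_tendsto' (a := (0 : ℝ)) (fun x _ => hexp x)
      (by simpa [IntegrableOn, mul_comm] using
        (integrableOn_pow_mul_cexp_neg_mul 0 hr).const_mul (-r))
      (m := 0) (by simpa using tendsto_pow_mul_cexp_neg_mul 0 hr)
    rw [integral_mul_const] at h
    simp only [pow_zero, one_mul, Nat.factorial_zero, Nat.cast_one, zero_add, pow_one]
    rw [eq_div_iff hr0]
    simp at h
    linear_combination h
  | succ n ih =>
    -- Integration by parts: the boundary terms vanish, so `r I (n + 1) = (n + 1) I n`.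
    have hd : ∀ x : ℝ, HasDerivAt (fun x : ℝ => (x : ℂ) ^ (n + 1) * Complex.exp (-(r * x)))
        ((n + 1) * ((x : ℂ) ^ n * Complex.exp (-(r * x)))
          - r * ((x : ℂ) ^ (n + 1) * Complex.exp (-(r * x)))) x := fun x => by
      convert! (((hasDerivAt_id x).ofReal_comp).pow (n + 1)).mul (hexp x) using 1
      simp
      ring
    have h := integral_Ioi_of_hasDerivAt_of_tendsto' (a := (0 : ℝ)) (fun x _ => hd x)
      (((integrableOn_pow_mul_cexp_neg_mul n hr).const_mul _).sub
        ((integrableOn_pow_mul_cexp_neg_mul (n + 1) hr).const_mul _))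
      (tendsto_pow_mul_cexp_neg_mul (n + 1) hr)
    rw [integral_sub ((integrableOn_pow_mul_cexp_neg_mul n hr).const_mul _)
        ((integrableOn_pow_mul_cexp_neg_mul (n + 1) hr).const_mul _),
      integral_const_mul, integral_const_mul, ih] at h
    rw [eq_div_iff (pow_ne_zero _ hr0), Nat.factorial_succ]
    simp only [Complex.ofReal_zero, ne_eq, Nat.add_eq_zero_iff, one_ne_zero, and_false,
      not_false_eq_true, zero_pow, zero_mul, sub_zero] at h
    field_simp at h
    push_cast
    linear_combination (-1) * h

/-- At variance `1/2` the density is `exp (-x²) / √π`, leaving a Gaussian integral with complex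
parameter `1 - c i`. Squaring removes the complex square root, and the square is exactly what two
independent coordinates produce. -/
lemma integral_cexp_mul_sq_gaussianReal (c : ℝ) :
    (∫ x, Complex.exp ((c * x ^ 2 : ℝ) * Complex.I) ∂gaussianReal 0 (1 / 2)) ^ 2
      = 1 / (1 - c * Complex.I) := by
  have hre : 0 < (1 - c * Complex.I).re := by simp
  have h0 : (1 - c * Complex.I) ≠ 0 := by intro h; rw [h] at hre; simp at hre
  have key : ∫ x, Complex.exp ((c * x ^ 2 : ℝ) * Complex.I) ∂gaussianReal 0 (1 / 2)
      = ((Real.sqrt Real.pi)⁻¹ : ℝ) * (Real.pi / (1 - c * Complex.I)) ^ (1 / 2 : ℂ) := by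
    rw [integral_gaussianReal_eq_integral_smul (by norm_num),
      ← integral_gaussian_complex hre, ← integral_const_mul]
    refine integral_congr_ae (ae_of_all _ fun x => ?_)
    simp only [gaussianPDFReal, Complex.real_smul]
    push_cast
    rw [mul_assoc, ← Complex.exp_add]
    congr 1
    · norm_num
      field_simp
    · congr 1
      norm_num
      ring
  have hpi : ((Real.sqrt Real.pi : ℝ) : ℂ) ^ 2 = Real.pi := by
    rw [← Complex.ofReal_pow, Real.sq_sqrt Real.pi_pos.le]
  rw [key, mul_pow, ← Complex.cpow_nat_mul]
  have hpi0 : (Real.pi : ℂ) ≠ 0 := by exact_mod_cast Real.pi_ne_zero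
  push_cast
  rw [inv_pow, hpi]
  norm_num
  field_simp

/-- The squared modulus of a standard complex Gaussian is exponential with mean `1`. -/
lemma integral_cexp_mul_normSq_stdComplexGaussian (c : ℝ) :
    ∫ z, Complex.exp ((c * ‖z‖ ^ 2 : ℝ) * Complex.I) ∂stdComplexGaussian
      = 1 / (1 - c * Complex.I) := by
  rw [stdComplexGaussian, integral_map_equiv, ← integral_cexp_mul_sq_gaussianReal, sq,
    ← integral_prod_mul]
  refine integral_congr_ae (ae_of_all _ fun x => ?_)
  simp only [← Complex.exp_add, Complex.sq_norm, Complex.normSq_apply,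
    Complex.measurableEquivRealProd_symm_apply]
  congr 1
  push_cast
  ring

lemma erlangPDF_eq {L : ℕ} (hL : 1 ≤ L) {g : ℝ} (hg : 0 < g) (x : ℝ) :
    erlangPDF L g x = (1 / (g ^ L * (L - 1).factorial)) * (x ^ (L - 1) * Real.exp (-(1 / g * x))) := by
  obtain ⟨n, rfl⟩ : ∃ n, L = n + 1 := ⟨L - 1, by omega⟩
  simp only [erlangPDF, Nat.add_sub_cancel, Nat.cast_add, Nat.cast_one, Real.Gamma_nat_eq_factorial]
  have : (n.factorial : ℝ) ≠ 0 := by exact_mod_cast n.factorial_ne_zero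
  rw [div_pow, show -(x / g) = -(1 / g * x) by ring]
  field_simp
  ring

lemma erlangPDF_nonneg {L : ℕ} (hL : 1 ≤ L) {g : ℝ} (hg : 0 < g) {x : ℝ} (hx : 0 ≤ x) :
    0 ≤ erlangPDF L g x := by
  rw [erlangPDF_eq hL hg]; positivity

lemma erlangPDF_pos {L : ℕ} (hL : 1 ≤ L) {g : ℝ} (hg : 0 < g) {x : ℝ} (hx : 0 < x) :
    0 < erlangPDF L g x := by
  rw [erlangPDF_eq hL hg]; positivity

lemma contDiff_erlangPDF (L : ℕ) (g : ℝ) : ContDiff ℝ 1 (erlangPDF L g) := by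
  unfold erlangPDF
  fun_prop

lemma integrableOn_erlangPDF {L : ℕ} (hL : 1 ≤ L) {g : ℝ} (hg : 0 < g) :
    IntegrableOn (erlangPDF L g) (Ioi 0) := by
  rw [funext (erlangPDF_eq hL hg)]
  exact (integrableOn_pow_mul_exp_neg_mul _ (by positivity)).const_mul _

/-- The Erlang distribution, as it enters the statement on the law of the SNR. -/
noncomputable def erlangMeasure (L : ℕ) (g : ℝ) : Measure ℝ :=
  (volume.restrict (Ioi (0 : ℝ))).withDensity (fun x => ENNReal.ofReal (erlangPDF L g x))

lemma isFiniteMeasure_erlangMeasure {L : ℕ} (hL : 1 ≤ L) {g : ℝ} (hg : 0 < g) :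
    IsFiniteMeasure (erlangMeasure L g) :=
  isFiniteMeasure_withDensity_ofReal (integrableOn_erlangPDF hL hg).2

lemma integral_erlangMeasure {E : Type*} [NormedAddCommGroup E] [NormedSpace ℝ E]
    {L : ℕ} (hL : 1 ≤ L) {g : ℝ} (hg : 0 < g) (f : ℝ → E) :
    ∫ x, f x ∂erlangMeasure L g = ∫ x in Ioi 0, erlangPDF L g x • f x := by
  rw [erlangMeasure, integral_withDensity_eq_integral_toReal_smul
    (contDiff_erlangPDF L g).continuous.measurable.ennreal_ofReal
    (ae_of_all _ fun _ => ENNReal.ofReal_lt_top)]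
  refine setIntegral_congr_fun measurableSet_Ioi fun x hx => ?_
  simp only [ENNReal.toReal_ofReal (erlangPDF_nonneg hL hg (le_of_lt hx))]

lemma charFun_erlangMeasure {L : ℕ} (hL : 1 ≤ L) {g : ℝ} (hg : 0 < g) (t : ℝ) :
    charFun (erlangMeasure L g) t = (1 / (1 - (t * g : ℝ) * Complex.I)) ^ L := by
  have hre : 0 < ((1 / g : ℝ) - t * Complex.I).re := by simp [hg]
  have h0 : ((1 / g : ℝ) - t * Complex.I) ≠ 0 := by intro h; rw [h] at hre; simp at hre
  have hg0 : (g : ℂ) ≠ 0 := by exact_mod_cast hg.ne'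
  rw [charFun_apply_real, integral_erlangMeasure hL hg]
  have : ∀ x : ℝ, erlangPDF L g x • Complex.exp (t * x * Complex.I)
      = (1 / (g ^ L * (L - 1).factorial) : ℝ) *
        ((x : ℂ) ^ (L - 1) * Complex.exp (-(((1 / g : ℝ) - t * Complex.I) * x))) := fun x => by
    rw [erlangPDF_eq hL hg, Complex.real_smul]
    push_cast
    rw [mul_assoc, mul_assoc, ← Complex.exp_add]
    congr 4
    ring
  simp_rw [this]
  rw [integral_const_mul, integral_pow_mul_cexp_neg_mul _ hre, Nat.sub_add_cancel hL]
  have hf : ((L - 1).factorial : ℂ) ≠ 0 := by exact_mod_cast (L - 1).factorial_ne_zero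
  have h1 : (1 - (t * g : ℝ) * Complex.I) = g * ((1 / g : ℝ) - t * Complex.I) := by
    push_cast
    field_simp
  rw [h1]
  push_cast at h0 ⊢
  rw [div_pow, one_pow, mul_pow]
  have := pow_ne_zero L h0
  field_simp

lemma mrcSNR_eq {L : ℕ} (P₀ N₀ : ℝ) (h : Fin L → ℂ) :
    mrcSNR P₀ N₀ h = P₀ / N₀ * ∑ l, ‖h l‖ ^ 2 := by
  have h1 : ∑ l, starRingEnd ℂ (h l) * h l = ((∑ l, ‖h l‖ ^ 2 : ℝ) : ℂ) := by
    push_cast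
    exact Finset.sum_congr rfl fun l _ => Complex.conj_mul' _
  have h0 : 0 ≤ ∑ l, ‖h l‖ ^ 2 := by positivity
  rw [mrcSNR, h1, Complex.norm_real, Real.norm_of_nonneg h0]
  simp only [RCLike.norm_conj, ← Finset.sum_mul]
  -- For a zero channel, `0 / 0 = 0` agrees with the right-hand side.
  rcases h0.eq_or_lt with h0 | h0
  · simp [← h0]
  · by_cases hN : N₀ = 0
    · simp [hN]
    · field_simp

/-- The SNR is Erlang distributed: both laws have the same characteristic function. -/
lemma hasLaw_sum_normSq {Ω : Type*} [MeasurableSpace Ω] {P : Measure Ω} [IsProbabilityMeasure P]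
    {L : ℕ} (hL : 1 ≤ L) {g : ℝ} (hg : 0 < g) {h : Fin L → Ω → ℂ} (hindep : iIndepFun h P)
    (hlaw : ∀ l, HasLaw (h l) stdComplexGaussian P) :
    HasLaw (fun ω => g * ∑ l, ‖h l ω‖ ^ 2) (erlangMeasure L g) P := by
  have hm : ∀ l, AEMeasurable (fun ω => g * ‖h l ω‖ ^ 2) P := fun l =>
    ((hlaw l).aemeasurable.norm.pow_const 2).const_mul g
  have hind : iIndepFun (fun l ω => g * ‖h l ω‖ ^ 2) P :=
    hindep.comp (fun _ z => g * ‖z‖ ^ 2) (fun _ => by fun_prop)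
  simp_rw [Finset.mul_sum]
  refine ⟨Finset.aemeasurable_fun_sum _ fun l _ => hm l, ?_⟩
  have := isFiniteMeasure_erlangMeasure hL hg
  refine Measure.ext_of_charFun ?_
  rw [hind.charFun_map_fun_sum_eq_prod hm]
  ext t
  rw [charFun_erlangMeasure hL hg, Finset.prod_apply,
    ← Fin.prod_const]
  refine Finset.prod_congr rfl fun l _ => ?_
  rw [charFun_apply_real, integral_map (hm l) (by fun_prop),
    ← integral_cexp_mul_normSq_stdComplexGaussian, ← (hlaw l).integral_comp (by fun_prop)]
  refine integral_congr_ae (ae_of_all _ fun ω => ?_)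
  simp [mul_assoc]

end ShortPacket

/-! ### The Gaussian tail and its deviation from a step -/

namespace ShortPacket

lemma integrable_exp_neg_sq_div_two : Integrable fun t : ℝ => Real.exp (-t ^ 2 / 2) := by
  refine (integrable_exp_neg_mul_sq (b := 1 / 2) (by norm_num)).congr (ae_of_all _ fun t => ?_)
  simp only
  congr 1
  ring

lemma integral_exp_neg_sq_div_two : ∫ t : ℝ, Real.exp (-t ^ 2 / 2) = Real.sqrt (2 * Real.pi) := by
  have h := integral_gaussian (1 / 2)
  rw [show Real.pi / (1 / 2) = 2 * Real.pi by ring] at h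
  rw [← h]
  congr 1 with t
  congr 1
  ring

lemma sqrt_two_pi_pos : 0 < Real.sqrt (2 * Real.pi) := Real.sqrt_pos.2 (by positivity)

lemma one_le_sqrt_two_pi : 1 ≤ Real.sqrt (2 * Real.pi) := by
  rw [Real.one_le_sqrt]
  have := Real.pi_gt_three
  linarith

lemma gaussQ_nonneg (x : ℝ) : 0 ≤ gaussQ x :=
  mul_nonneg (by positivity) (integral_nonneg fun _ => (Real.exp_pos _).le)

lemma gaussQ_antitone : Antitone gaussQ := fun x y hxy =>
  mul_le_mul_of_nonneg_left (setIntegral_mono_set integrable_exp_neg_sq_div_two.integrableOn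
    (ae_of_all _ fun _ => (Real.exp_pos _).le) (Ioi_subset_Ioi hxy).eventuallyLE) (by positivity)

lemma gaussQ_add_gaussQ_neg (x : ℝ) : gaussQ x + gaussQ (-x) = 1 := by
  have h : ∫ t in Ioi (-x), Real.exp (-t ^ 2 / 2) = ∫ t in Iic x, Real.exp (-t ^ 2 / 2) := by
    rw [← integral_comp_neg_Iic]
    simp
  rw [gaussQ, gaussQ, h, ← mul_add, add_comm, intervalIntegral.integral_Iic_add_Ioi
    integrable_exp_neg_sq_div_two.integrableOn integrable_exp_neg_sq_div_two.integrableOn,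
    integral_exp_neg_sq_div_two]
  have := sqrt_two_pi_pos
  field_simp

lemma gaussQ_le_one (x : ℝ) : gaussQ x ≤ 1 := by
  linarith [gaussQ_add_gaussQ_neg x, gaussQ_nonneg (-x)]

/-- For `t ≥ x ≥ 0`, `t² ≥ x² + (t - x)²`; the shifted Gaussian is then integrated over the whole
line. -/
lemma gaussQ_le_exp {x : ℝ} (hx : 0 ≤ x) : gaussQ x ≤ Real.exp (-x ^ 2 / 2) := by
  have hint : Integrable fun t : ℝ => Real.exp (-x ^ 2 / 2) * Real.exp (-(t - x) ^ 2 / 2) :=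
    (integrable_exp_neg_sq_div_two.comp_sub_right x).const_mul _
  have h1 : ∫ t in Ioi x, Real.exp (-t ^ 2 / 2)
      ≤ Real.exp (-x ^ 2 / 2) * Real.sqrt (2 * Real.pi) :=
    calc ∫ t in Ioi x, Real.exp (-t ^ 2 / 2)
        ≤ ∫ t in Ioi x, Real.exp (-x ^ 2 / 2) * Real.exp (-(t - x) ^ 2 / 2) := by
          refine setIntegral_mono_on integrable_exp_neg_sq_div_two.integrableOn hint.integrableOn
            measurableSet_Ioi fun t ht => ?_
          rw [← Real.exp_add]
          have : x < t := ht
          exact Real.exp_le_exp.2 (by nlinarith)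
      _ ≤ ∫ t, Real.exp (-x ^ 2 / 2) * Real.exp (-(t - x) ^ 2 / 2) :=
          setIntegral_le_integral hint (ae_of_all _ fun _ => by positivity)
      _ = _ := by
          rw [integral_const_mul, integral_sub_right_eq_self (fun t : ℝ => Real.exp (-t ^ 2 / 2)),
            integral_exp_neg_sq_div_two]
  rw [gaussQ, one_div, inv_mul_le_iff₀ sqrt_two_pi_pos, mul_comm]
  exact h1

lemma gaussQ_sub_le {m x y : ℝ} (hm : 0 ≤ m) (hmx : m ≤ x) (hxy : x ≤ y) :
    gaussQ x - gaussQ y ≤ Real.exp (-m ^ 2 / 2) * (y - x) := by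
  have hi := integrable_exp_neg_sq_div_two
  have h : ∫ t in Ioi x, Real.exp (-t ^ 2 / 2)
      = (∫ t in x..y, Real.exp (-t ^ 2 / 2)) + ∫ t in Ioi y, Real.exp (-t ^ 2 / 2) :=
    (intervalIntegral.integral_interval_add_Ioi hi.integrableOn hi.integrableOn).symm
  have h2 : ∫ t in x..y, Real.exp (-t ^ 2 / 2) ≤ Real.exp (-m ^ 2 / 2) * (y - x) := by
    refine (le_abs_self _).trans ?_
    rw [← abs_of_nonneg (sub_nonneg.2 hxy)]
    refine intervalIntegral.norm_integral_le_of_norm_le_const (E := ℝ) fun t ht => ?_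
    rw [uIoc_of_le hxy] at ht
    rw [Real.norm_eq_abs, Real.abs_exp]
    exact Real.exp_le_exp.2 (by nlinarith [ht.1])
  have h3 : 0 ≤ Real.exp (-m ^ 2 / 2) * (y - x) :=
    mul_nonneg (Real.exp_pos _).le (sub_nonneg.2 hxy)
  rw [gaussQ, gaussQ, h, ← mul_sub, add_sub_cancel_right, one_div,
    inv_mul_le_iff₀ sqrt_two_pi_pos]
  nlinarith [one_le_sqrt_two_pi]

/-- The deviation of the Q-function from its limiting step function; it is odd. -/
noncomputable def gaussDev (x : ℝ) : ℝ := gaussQ x - (1 - Real.sign x) / 2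

lemma gaussDev_neg (x : ℝ) : gaussDev (-x) = -gaussDev x := by
  rw [gaussDev, gaussDev, Real.sign_neg]
  linarith [gaussQ_add_gaussQ_neg x]

lemma gaussDev_of_pos {x : ℝ} (hx : 0 < x) : gaussDev x = gaussQ x := by
  simp [gaussDev, Real.sign_of_pos hx]

lemma gaussDev_zero : gaussDev 0 = 0 := by
  have h := gaussDev_neg 0
  rw [neg_zero] at h
  linarith

lemma abs_gaussDev_le (x : ℝ) : |gaussDev x| ≤ Real.exp (-x ^ 2 / 2) := by
  have key : ∀ y : ℝ, 0 < y → |gaussDev y| ≤ Real.exp (-y ^ 2 / 2) := fun y hy => by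
    rw [gaussDev_of_pos hy, abs_of_nonneg (gaussQ_nonneg y)]
    exact gaussQ_le_exp hy.le
  rcases lt_trichotomy x 0 with h | rfl | h
  · simpa [gaussDev_neg] using key (-x) (by linarith)
  · simp [gaussDev_zero]
  · exact key x h

lemma abs_gaussDev_le_one (x : ℝ) : |gaussDev x| ≤ 1 :=
  (abs_gaussDev_le x).trans (Real.exp_le_one_iff.2 (by nlinarith [sq_nonneg x]))

/-- `gaussDev` jumps at `0`, so a Lipschitz bound needs both points on one side; distance `m` from
the jump makes the constant exponentially small. -/
lemma abs_gaussDev_sub_le_of_pos {m x y : ℝ} (hm : 0 < m) (hx : m ≤ x) (hy : m ≤ y) :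
    |gaussDev x - gaussDev y| ≤ Real.exp (-m ^ 2 / 2) * |x - y| := by
  wlog hxy : x ≤ y generalizing x y
  · rw [abs_sub_comm, abs_sub_comm x]
    exact this hy hx (le_of_not_ge hxy)
  rw [gaussDev_of_pos (hm.trans_le hx), gaussDev_of_pos (hm.trans_le hy),
    abs_of_nonneg (sub_nonneg.2 (gaussQ_antitone hxy)), abs_sub_comm,
    abs_of_nonneg (sub_nonneg.2 hxy)]
  exact gaussQ_sub_le hm.le hx hxy

lemma measurable_sign : Measurable Real.sign := by
  unfold Real.sign
  exact Measurable.ite measurableSet_Iio measurable_const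
    (Measurable.ite measurableSet_Ioi measurable_const measurable_const)

lemma measurable_gaussQ : Measurable gaussQ := gaussQ_antitone.measurable

lemma measurable_gaussDev : Measurable gaussDev :=
  measurable_gaussQ.sub ((measurable_const.sub measurable_sign).div_const 2)

lemma integral_gaussDev_symm (c x₀ η : ℝ) :
    ∫ x in (x₀ - η)..(x₀ + η), gaussDev (c * (x - x₀)) = 0 := by
  rw [intervalIntegral.integral_comp_sub_right (fun u => gaussDev (c * u))]
  have h := intervalIntegral.integral_comp_neg (fun u => gaussDev (c * u)) (a := -η) (b := η)
  simp only [mul_neg, gaussDev_neg, intervalIntegral.integral_neg, neg_neg] at h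
  rw [show x₀ - η - x₀ = -η by ring, show x₀ + η - x₀ = η by ring]
  linarith

/-- Serves to absorb a factor `s |u|` into part of the Gaussian decay. -/
lemma mul_exp_neg_mul_sq_le {b : ℝ} (hb : 0 < b) (y : ℝ) :
    y * Real.exp (-(b * y ^ 2)) ≤ 1 + 1 / b := by
  have h1 := Real.add_one_le_exp (b * y ^ 2)
  have h2 : y ≤ (1 + 1 / b) * (b * y ^ 2 + 1) := by
    have : (1 + 1 / b) * (b * y ^ 2 + 1) = b * y ^ 2 + 1 + y ^ 2 + 1 / b := by
      field_simp
      ring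
    rw [this]
    have : 0 < 1 / b := by positivity
    nlinarith [sq_nonneg (y - 1), mul_nonneg hb.le (sq_nonneg y)]
  rw [Real.exp_neg, ← div_eq_mul_inv, div_le_iff₀ (Real.exp_pos _)]
  exact h2.trans (mul_le_mul_of_nonneg_left h1 (by positivity))

lemma integrable_abs_mul_exp_neg_mul_sq {b : ℝ} (hb : 0 < b) :
    Integrable fun u : ℝ => |u| * Real.exp (-(b * u ^ 2)) := by
  refine (integrable_mul_exp_neg_mul_sq hb).abs.congr (ae_of_all _ fun u => ?_)
  simp [abs_mul]

lemma integrable_scaled_abs_mul_exp {b s : ℝ} (hb : 0 < b) (hs : 0 < s) (x₀ : ℝ) :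
    Integrable fun x : ℝ => |x - x₀| * Real.exp (-(b * (s * (x - x₀)) ^ 2)) := by
  have h := (integrable_abs_mul_exp_neg_mul_sq (b := b * s ^ 2) (by positivity)).comp_sub_right x₀
  refine h.congr (ae_of_all _ fun x => ?_)
  simp only
  congr 3
  ring

/-- Source of the rate: one factor `1/s` comes from the substitution and one from the weight `|x -
x₀|`. -/
lemma integral_scaled_abs_mul_exp {b s : ℝ} (hs : 0 < s) (x₀ : ℝ) :
    ∫ x, |x - x₀| * Real.exp (-(b * (s * (x - x₀)) ^ 2))
      = (∫ u, |u| * Real.exp (-(b * u ^ 2))) / s ^ 2 := by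
  rw [integral_sub_right_eq_self (fun u : ℝ => |u| * Real.exp (-(b * (s * u) ^ 2)))]
  have h := Measure.integral_comp_mul_left (fun u : ℝ => |u| * Real.exp (-(b * u ^ 2))) s
  have h2 : ∀ x : ℝ, |s * x| * Real.exp (-(b * (s * x) ^ 2))
      = s * (|x| * Real.exp (-(b * (s * x) ^ 2))) := fun x => by
    rw [abs_mul, abs_of_pos hs, mul_assoc]
  simp only [h2, integral_const_mul, abs_of_pos (inv_pos.2 hs), smul_eq_mul] at h
  rw [eq_div_iff (by positivity), ← mul_inv_cancel_left₀ hs.ne'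
    (∫ u, |u| * Real.exp (-(b * u ^ 2))), ← h]
  ring

/-- Second order Taylor estimate at a point. -/
lemma exists_abs_sub_linear_le {f : ℝ → ℝ} {x₀ : ℝ} (hf : ContDiffAt ℝ 2 f x₀) :
    ∃ K, 0 ≤ K ∧ ∀ᶠ x in nhds x₀, |f x - f x₀ - deriv f x₀ * (x - x₀)| ≤ K * (x - x₀) ^ 2 := by
  have hd : ∀ᶠ x in nhds x₀, DifferentiableAt ℝ f x :=
    (hf.eventually (by simp)).mono fun x hx => hx.differentiableAt (by simp)
  have hd2 : DifferentiableAt ℝ (deriv f) x₀ := by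
    have : ContDiffAt ℝ 1 (deriv f) x₀ := hf.derivWithin (by norm_num)
    exact this.differentiableAt (by simp)
  obtain ⟨K, hK0, hK⟩ := hd2.isBigO_sub.exists_nonneg
  rw [isBigOWith_iff] at hK
  obtain ⟨ε, hε, hball⟩ := Metric.eventually_nhds_iff_ball.1 (hd.and hK)
  refine ⟨K, hK0, Metric.eventually_nhds_iff_ball.2 ⟨ε, hε, fun x hx => ?_⟩⟩
  have hsub : ∀ y ∈ uIcc x₀ x, |y - x₀| ≤ |x - x₀| := fun y hy => abs_sub_left_of_mem_uIcc hy
  have hmem : ∀ y ∈ uIcc x₀ x, y ∈ Metric.ball x₀ ε := fun y hy =>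
    (hsub y hy).trans_lt (by simpa [Real.dist_eq] using hx)
  have h := (convex_uIcc x₀ x).norm_image_sub_le_of_norm_hasDerivWithin_le
    (f := fun y => f y - deriv f x₀ * (y - x₀)) (f' := fun y => deriv f y - deriv f x₀)
    (C := K * |x - x₀|)
    (fun y hy => by
      have := ((hball y (hmem y hy)).1.hasDerivAt).sub
        (((hasDerivAt_id y).sub_const x₀).const_mul (deriv f x₀))
      rw [mul_one] at this
      exact this.hasDerivWithinAt)
    (fun y hy => ((hball y (hmem y hy)).2).trans
      (mul_le_mul_of_nonneg_left (hsub y hy) hK0)) left_mem_uIcc right_mem_uIcc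
  simp only [Real.norm_eq_abs, sub_self, mul_zero, sub_zero] at h
  rw [mul_assoc, abs_mul_abs_self, ← sq] at h
  convert! h using 2
  ring

end ShortPacket

/-! ### Smoothed step against a density -/

namespace ShortPacket

/-- For `u > 0` the smallness of `K |u|` keeps both `f` and `a u` above `(a / 2) u`, on the same
side of the jump; `u < 0` follows by oddness. -/
lemma abs_gaussDev_sub_le_linear {a K s u f : ℝ} (ha : 0 < a) (hs : 0 < s)
    (hf : |f - a * u| ≤ K * u ^ 2) (hK : K * |u| ≤ a / 2) :
    |gaussDev (s * f) - gaussDev (s * (a * u))|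
      ≤ Real.exp (-(s * (a / 2) * u) ^ 2 / 2) * (s * (K * u ^ 2)) := by
  wlog hu : 0 ≤ u generalizing u f
  · have h := this (u := -u) (f := -f) (by rwa [← abs_neg, neg_sq, show -(-f - a * -u) = f - a * u by ring])
      (by rwa [abs_neg]) (by linarith)
    rw [show s * -f = -(s * f) by ring, show s * (a * -u) = -(s * (a * u)) by ring, gaussDev_neg,
      gaussDev_neg, ← abs_neg, neg_sq] at h
    convert! h using 2
    · ring
    · rw [mul_neg, neg_sq]
  rcases hu.eq_or_lt with rfl | hu
  · have : f = 0 := by simpa using hf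
    simp [this]
  rw [abs_of_pos hu] at hK
  have h1 : K * u ^ 2 ≤ a / 2 * u := by nlinarith
  have h2 := (abs_le.1 hf).1
  refine (abs_gaussDev_sub_le_of_pos (m := s * (a / 2) * u) (by positivity) ?_ ?_).trans ?_
  · rw [mul_assoc]
    exact mul_le_mul_of_nonneg_left (by linarith) hs.le
  · rw [mul_assoc]
    exact mul_le_mul_of_nonneg_left (by nlinarith) hs.le
  · rw [← mul_sub, abs_mul, abs_of_pos hs]
    gcongr

lemma abs_gaussDev_mul_sub_le {a K M s u f p p₀ : ℝ} (ha : 0 < a) (hs : 0 < s) (hK0 : 0 ≤ K)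
    (hf : |f - a * u| ≤ K * u ^ 2) (hK : K * |u| ≤ a / 2) (hp : |p - p₀| ≤ M * |u|)
    (hM : |p| ≤ M) :
    |gaussDev (s * f) * p - gaussDev (s * (a * u)) * p₀|
      ≤ (M * (K * (1 + 1 / (a ^ 2 / 16)) + 1))
        * (|u| * Real.exp (-(a ^ 2 / 16 * (s * u) ^ 2))) := by
  set E := Real.exp (-(a ^ 2 / 16 * (s * u) ^ 2)) with hE
  have hE0 : 0 < E := Real.exp_pos _
  have hM0 : 0 ≤ M := (abs_nonneg p).trans hM
  have h1 : |gaussDev (s * f) - gaussDev (s * (a * u))|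
      ≤ K * (1 + 1 / (a ^ 2 / 16)) * (|u| * E) := by
    refine (abs_gaussDev_sub_le_linear ha hs hf hK).trans ?_
    have hy := mul_exp_neg_mul_sq_le (b := a ^ 2 / 16) (by positivity) (s * |u|)
    rw [mul_pow s, sq_abs, ← mul_pow, ← hE] at hy
    -- The exponent `a² s² u² / 8` is twice that of `E`: one copy of `E` absorbs `s |u|`, the other
    -- is kept for integration.
    have hsplit : Real.exp (-(s * (a / 2) * u) ^ 2 / 2) = E * E := by
      rw [hE, ← Real.exp_add]
      congr 1
      ring
    calc Real.exp (-(s * (a / 2) * u) ^ 2 / 2) * (s * (K * u ^ 2))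
        = K * (s * |u| * E) * (|u| * E) := by rw [hsplit, ← sq_abs u]; ring
      _ ≤ _ := by gcongr
  have h2 : |gaussDev (s * (a * u))| ≤ E := by
    refine (abs_gaussDev_le _).trans (Real.exp_le_exp.2 ?_)
    have : 0 ≤ a ^ 2 * (s * u) ^ 2 := by positivity
    rw [show (s * (a * u)) ^ 2 = a ^ 2 * (s * u) ^ 2 by ring]
    linarith
  calc |gaussDev (s * f) * p - gaussDev (s * (a * u)) * p₀|
      = |(gaussDev (s * f) - gaussDev (s * (a * u))) * p
          + gaussDev (s * (a * u)) * (p - p₀)| := by congr 1; ring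
    _ ≤ |gaussDev (s * f) - gaussDev (s * (a * u))| * |p|
          + |gaussDev (s * (a * u))| * |p - p₀| := by
        rw [← abs_mul, ← abs_mul]
        exact abs_add_le _ _
    _ ≤ K * (1 + 1 / (a ^ 2 / 16)) * (|u| * E) * M + E * (M * |u|) := by gcongr
    _ = _ := by ring

/-- Off the zero of `F`, `exp (-z) ≤ 1 / z` with `z = (c s)² / 2` already suffices. -/
lemma abs_gaussDev_mul_le {c s f p : ℝ} (hc : 0 < c) (hs : 0 < s) (hf : c ≤ |f|) (hp : 0 ≤ p) :
    |gaussDev (s * f) * p| ≤ 2 / c ^ 2 / s ^ 2 * p := by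
  rw [abs_mul, abs_of_nonneg hp]
  refine mul_le_mul_of_nonneg_right ((abs_gaussDev_le _).trans ?_) hp
  have h1 : (c * s) ^ 2 ≤ (s * f) ^ 2 := by
    rw [← sq_abs (s * f), abs_mul, abs_of_pos hs, mul_comm c]
    gcongr
  have h2 : 0 < (c * s) ^ 2 / 2 := by positivity
  calc Real.exp (-(s * f) ^ 2 / 2) ≤ Real.exp (-((c * s) ^ 2 / 2)) :=
        Real.exp_le_exp.2 (by linarith)
    _ ≤ ((c * s) ^ 2 / 2)⁻¹ := by
        rw [Real.exp_neg]
        exact inv_anti₀ h2 (by linarith [Real.add_one_le_exp ((c * s) ^ 2 / 2)])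
    _ = _ := by field_simp

/-- The mass that the smoothed step `gaussQ (s * F x)` puts against a density differs from that of
the sharp step at the zero `x₀` of `F` by `O(s⁻²)`: the first order term cancels by oddness. -/
lemma exists_abs_integral_gaussDev_le {F p : ℝ → ℝ} {x₀ : ℝ} (hx₀ : 0 < x₀)
    (hFm : Measurable F) (hF : ContDiffAt ℝ 2 F x₀) (hF0 : F x₀ = 0) (hF' : 0 < deriv F x₀)
    (hFfar : ∀ η, 0 < η → ∃ c, 0 < c ∧ ∀ x, 0 < x → η ≤ |x - x₀| → c ≤ |F x|)
    (hp : IntegrableOn p (Ioi 0)) (hp0 : ∀ x, 0 < x → 0 ≤ p x) (hpd : DifferentiableAt ℝ p x₀) :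
    ∃ K, ∀ s, 0 < s → |∫ x in Ioi 0, gaussDev (s * F x) * p x| ≤ K / s ^ 2 := by
  obtain ⟨K, hK0, hK⟩ := exists_abs_sub_linear_le hF
  set a := deriv F x₀ with ha
  obtain ⟨M₁, hM₁0, hM₁⟩ := hpd.isBigO_sub.exists_nonneg
  rw [isBigOWith_iff] at hM₁
  have hcont : Tendsto (fun x => K * |x - x₀|) (nhds x₀) (nhds 0) := by
    have : ContinuousAt (fun x => K * |x - x₀|) x₀ := by fun_prop
    simpa [ContinuousAt] using this
  have hpc : ∀ᶠ x in nhds x₀, |p x| < |p x₀| + 1 :=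
    hpd.continuousAt.abs.eventually_lt continuousAt_const (by linarith)
  obtain ⟨η₁, hη₁, hloc⟩ := Metric.eventually_nhds_iff.1
    (hK.and (hM₁.and ((hcont.eventually_lt_const (half_pos hF')).and hpc)))
  -- The bound by `x₀ / 2` keeps the symmetric window inside `(0, ∞)`; truncating it would spoil the
  -- cancellation.
  set η := min (η₁ / 2) (x₀ / 2) with hη
  have hη0 : 0 < η := by positivity
  have hηx : η < x₀ := (min_le_right _ _).trans_lt (by linarith)
  obtain ⟨c, hc, hfar⟩ := hFfar η hη0
  -- A single constant for both the local bound on `p` and its Lipschitz bound at `x₀`.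
  set M := M₁ + (|p x₀| + 1) with hM
  set b := a ^ 2 / 16 with hb
  have hb0 : 0 < b := by positivity
  set K₁ := M * (K * (1 + 1 / b) + 1) with hK₁
  have hK₁0 : 0 ≤ K₁ := by positivity
  refine ⟨K₁ * (∫ u, |u| * Real.exp (-(b * u ^ 2))) + 2 / c ^ 2 * ∫ x in Ioi 0, p x,
    fun s hs => ?_⟩
  let I : Set ℝ := Ioc (x₀ - η) (x₀ + η)
  -- The odd comparison term, with tangent slope and frozen density; its integral is zero.
  let T : ℝ → ℝ := I.indicator fun x => gaussDev (s * (a * (x - x₀))) * p x₀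
  have hTint : IntegrableOn T (Ioi 0) := by
    refine Integrable.integrableOn ?_
    refine (integrable_indicator_iff measurableSet_Ioc).2 ?_
    refine Measure.integrableOn_of_bounded (M := |p x₀|) (by simp)
      ((measurable_gaussDev.comp (by fun_prop)).mul_const _).aestronglyMeasurable
      (ae_of_all _ fun x => ?_)
    rw [norm_mul, Real.norm_eq_abs, Real.norm_eq_abs]
    exact mul_le_of_le_one_left (abs_nonneg _) (abs_gaussDev_le_one _)
  have hsub : Ioc (x₀ - η) (x₀ + η) ⊆ Ioi 0 :=
    Ioc_subset_Ioi_self.trans (Ioi_subset_Ioi (by linarith))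
  have hT : ∫ x in Ioi 0, T x = 0 := by
    rw [setIntegral_indicator measurableSet_Ioc, inter_eq_right.2 hsub,
      integral_mul_const, ← intervalIntegral.integral_of_le (by linarith)]
    simp_rw [← mul_assoc]
    rw [integral_gaussDev_symm, zero_mul]
  have hDint : IntegrableOn (fun x => gaussDev (s * F x) * p x) (Ioi 0) :=
    hp.bdd_mul (measurable_gaussDev.comp (hFm.const_mul s)).aestronglyMeasurable
      (ae_of_all _ fun x => abs_gaussDev_le_one _)
  have hbi := integrable_scaled_abs_mul_exp hb0 hs x₀
  have hbound : ∀ x ∈ Ioi (0 : ℝ), ‖gaussDev (s * F x) * p x - T x‖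
      ≤ K₁ * (|x - x₀| * Real.exp (-(b * (s * (x - x₀)) ^ 2))) + 2 / c ^ 2 / s ^ 2 * p x := by
    intro x hx
    have hpx := hp0 x hx
    rw [Real.norm_eq_abs]
    by_cases hxI : x ∈ I
    · have hxη : |x - x₀| ≤ η := abs_le.2 ⟨by linarith [hxI.1], by linarith [hxI.2]⟩
      obtain ⟨h1, h2, h3, h4⟩ := hloc (y := x)
        (by rw [Real.dist_eq]; exact hxη.trans_lt ((min_le_left _ _).trans_lt (by linarith)))
      rw [hF0, sub_zero] at h1
      have hpos : 0 ≤ 2 / c ^ 2 / s ^ 2 * p x := by positivity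
      have hle : M₁ * |x - x₀| ≤ M * |x - x₀| := by
        gcongr
        rw [hM]
        linarith [abs_nonneg (p x₀)]
      have := abs_gaussDev_mul_sub_le (M := M) hF' hs hK0 h1 h3.le (h2.trans hle)
        (by linarith)
      rw [← hb, ← hK₁] at this
      simp only [T, indicator_of_mem hxI]
      linarith
    · have hxη : η ≤ |x - x₀| := by
        by_contra! h
        have := abs_lt.1 h
        exact hxI ⟨by linarith, by linarith⟩
      have hpos : 0 ≤ K₁ * (|x - x₀| * Real.exp (-(b * (s * (x - x₀)) ^ 2))) := by positivity
      have := abs_gaussDev_mul_le hc hs (hfar x hx hxη) hpx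
      simp only [T, indicator_of_notMem hxI, sub_zero]
      linarith
  have heq : ∫ x in Ioi 0, gaussDev (s * F x) * p x
      = ∫ x in Ioi 0, (gaussDev (s * F x) * p x - T x) := by
    rw [integral_sub hDint hTint, hT, sub_zero]
  rw [heq, ← Real.norm_eq_abs]
  refine (norm_integral_le_of_norm_le ((hbi.integrableOn.const_mul K₁).add
    (hp.const_mul (2 / c ^ 2 / s ^ 2)))
    ((ae_restrict_iff' measurableSet_Ioi).2 (ae_of_all _ hbound))).trans ?_
  simp only [Pi.add_apply]
  rw [integral_add (hbi.integrableOn.const_mul K₁) (hp.const_mul (2 / c ^ 2 / s ^ 2)),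
    integral_const_mul, integral_const_mul, add_div, mul_div_assoc,
    ← integral_scaled_abs_mul_exp hs x₀]
  refine add_le_add (mul_le_mul_of_nonneg_left
    (setIntegral_le_integral hbi (ae_of_all _ fun _ => by positivity)) hK₁0) (le_of_eq ?_)
  ring

/-- The normalized margin of the capacity at SNR `g` over the rate whose threshold SNR is `x₀`. -/
noncomputable def margin (x₀ g : ℝ) : ℝ :=
  (Real.log (1 + g) - Real.log (1 + x₀)) * ((1 + g) / Real.sqrt (g * (2 + g)))

/-! ### Zero, slope and separation of `margin` -/

/-- Because `g (2 + g) = (1 + g)² - 1`. Hence `|margin|` dominates the logarithmic difference. -/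
lemma one_le_margin_factor {g : ℝ} (hg : 0 < g) : 1 ≤ (1 + g) / Real.sqrt (g * (2 + g)) := by
  rw [one_le_div (Real.sqrt_pos.2 (by positivity)), Real.sqrt_le_left (by positivity)]
  nlinarith

lemma measurable_margin (x₀ : ℝ) : Measurable (margin x₀) := by
  unfold margin
  fun_prop

lemma margin_self (x₀ : ℝ) : margin x₀ x₀ = 0 := by simp [margin]

lemma contDiffAt_margin {x₀ : ℝ} (hx₀ : 0 < x₀) : ContDiffAt ℝ 2 (margin x₀) x₀ := by
  unfold margin
  have h1 : (1 + x₀) ≠ 0 := by positivity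
  have h2 : x₀ * (2 + x₀) ≠ 0 := by positivity
  have h3 : Real.sqrt (x₀ * (2 + x₀)) ≠ 0 := (Real.sqrt_pos.2 (by positivity)).ne'
  have hl : ContDiffAt ℝ 2 (fun g => Real.log (1 + g)) x₀ :=
    ContDiffAt.log (by fun_prop) h1
  have hs : ContDiffAt ℝ 2 (fun g => Real.sqrt (g * (2 + g))) x₀ :=
    ContDiffAt.sqrt (by fun_prop) h2
  exact (hl.sub contDiffAt_const).mul (ContDiffAt.div (by fun_prop) hs h3)

lemma deriv_margin_pos {x₀ : ℝ} (hx₀ : 0 < x₀) : 0 < deriv (margin x₀) x₀ := by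
  have h3 : Real.sqrt (x₀ * (2 + x₀)) ≠ 0 := (Real.sqrt_pos.2 (by positivity)).ne'
  have hl : HasDerivAt (fun g => Real.log (1 + g) - Real.log (1 + x₀)) (1 / (1 + x₀)) x₀ :=
    (((hasDerivAt_id x₀).const_add 1).log (by positivity)).sub_const _
  have hs : DifferentiableAt ℝ (fun g => (1 + g) / Real.sqrt (g * (2 + g))) x₀ := by
    have : DifferentiableAt ℝ (fun g => Real.sqrt (g * (2 + g))) x₀ :=
      DifferentiableAt.sqrt (by fun_prop) (by positivity)
    exact DifferentiableAt.div (by fun_prop) this h3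
  have h : HasDerivAt (margin x₀) _ x₀ := hl.mul hs.hasDerivAt
  -- The logarithmic difference vanishes at `x₀`, so the derivative of the other factor drops out.
  rw [h.deriv, sub_self, zero_mul, add_zero]
  have := one_le_margin_factor hx₀
  positivity

lemma margin_pos_iff {x₀ g : ℝ} (hx₀ : 0 < x₀) (hg : 0 < g) : 0 < margin x₀ g ↔ x₀ < g := by
  have h := one_le_margin_factor hg
  rw [margin, mul_pos_iff_of_pos_right (by linarith), sub_pos,
    Real.log_lt_log_iff (by linarith) (by linarith), add_lt_add_iff_left]

lemma margin_neg_iff {x₀ g : ℝ} (hx₀ : 0 < x₀) (hg : 0 < g) : margin x₀ g < 0 ↔ g < x₀ := by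
  have h := one_le_margin_factor hg
  rw [margin, ← neg_pos, ← neg_mul, mul_pos_iff_of_pos_right (by linarith), neg_sub, sub_pos,
    Real.log_lt_log_iff (by linarith) (by linarith), add_lt_add_iff_left]

lemma exists_le_abs_margin {x₀ : ℝ} (hx₀ : 0 < x₀) (η : ℝ) (hη : 0 < η) :
    ∃ c, 0 < c ∧ ∀ x, 0 < x → η ≤ |x - x₀| → c ≤ |margin x₀ x| := by
  have hr : 0 < Real.log (1 + (x₀ + η)) - Real.log (1 + x₀) :=
    sub_pos.2 (Real.log_lt_log (by linarith) (by linarith))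
  have hl : 0 < η / (1 + x₀) := by positivity
  -- Above `x₀` the gap follows from monotonicity of `log`; below, from `log y ≥ 1 - 1 / y` at `y =
  -- (1 + x₀) / (1 + x)`.
  refine ⟨min (Real.log (1 + (x₀ + η)) - Real.log (1 + x₀)) (η / (1 + x₀)), lt_min hr hl,
    fun x hx hxη => ?_⟩
  have h := one_le_margin_factor hx
  rw [margin, abs_mul, abs_of_pos (by linarith : 0 < (1 + x) / Real.sqrt (x * (2 + x)))]
  refine le_trans ?_ (le_mul_of_one_le_right (abs_nonneg _) h)
  rcases le_abs.1 hxη with h | h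
  · refine (min_le_left _ _).trans (le_trans ?_ (le_abs_self _))
    exact sub_le_sub_right (Real.log_le_log (by linarith) (by linarith)) _
  · refine (min_le_right _ _).trans (le_trans ?_ (neg_le_abs _))
    rw [neg_sub, ← Real.log_div (by linarith) (by linarith)]
    have h2 := Real.one_sub_inv_le_log_of_pos (x := (1 + x₀) / (1 + x)) (by positivity)
    refine le_trans ?_ h2
    rw [inv_div, div_le_iff₀ (by linarith), sub_mul, div_mul_cancel₀ _ (by linarith)]
    linarith

/-! ### Packet loss as a smoothed step, and the expansion -/

/-- The factor `1 / log 2` occurs both in `C - Rc` and in `√V`, and cancels. -/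
lemma packetLoss_eq (N : ℕ) (Rc : ℝ) {g : ℝ} (hg : 0 < g) :
    packetLoss N Rc g = gaussQ (Real.sqrt N * margin ((2 : ℝ) ^ Rc - 1) g) := by
  have hlog : 0 < Real.log 2 := Real.log_pos (by norm_num)
  have hV : Real.sqrt (dispersion g) = Real.sqrt (g * (2 + g)) / (1 + g) * (1 / Real.log 2) := by
    rw [dispersion, Real.logb, Real.log_exp, Real.sqrt_mul (by positivity),
      Real.sqrt_sq (by positivity), Real.sqrt_div (by positivity), Real.sqrt_sq (by positivity)]
  have h3 : Real.sqrt (g * (2 + g)) ≠ 0 := (Real.sqrt_pos.2 (by positivity)).ne'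
  have h4 : Real.log (1 + ((2 : ℝ) ^ Rc - 1)) = Rc * Real.log 2 := by
    rw [add_sub_cancel, Real.log_rpow (by norm_num)]
  rw [packetLoss, Real.sqrt_div (by positivity), hV, margin, h4, capacity, Real.logb]
  congr 1
  field_simp

lemma measurable_packetLoss (N : ℕ) (Rc : ℝ) : Measurable (packetLoss N Rc) := by
  refine measurable_gaussQ.comp ?_
  unfold dispersion capacity Real.logb
  fun_prop

lemma abs_packetLoss_le_one (N : ℕ) (Rc g : ℝ) : |packetLoss N Rc g| ≤ 1 := by
  rw [packetLoss, abs_of_nonneg (gaussQ_nonneg _)]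
  exact gaussQ_le_one _

lemma integrableOn_packetLoss_mul {p : ℝ → ℝ} (hp : IntegrableOn p (Ioi 0)) (N : ℕ) (Rc : ℝ) :
    IntegrableOn (fun g => packetLoss N Rc g * p g) (Ioi 0) :=
  hp.bdd_mul (measurable_packetLoss N Rc).aestronglyMeasurable
    (ae_of_all _ fun x => abs_packetLoss_le_one N Rc x)

/-- The sign of `margin` turns the limiting step into the indicator of `(0, x₀]`. At `x₀` itself the
step takes the value `1/2`, hence the restriction to almost every `g`; `N ≥ 1` ensures that scaling
by `√N` preserves the sign. -/
lemma integral_packetLoss_mul {p : ℝ → ℝ} (hp : IntegrableOn p (Ioi 0)) {N : ℕ} (hN : 1 ≤ N)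
    {Rc : ℝ} (hRc : 0 < Rc) :
    ∫ g in Ioi 0, packetLoss N Rc g * p g
      = (∫ g in Ioc 0 ((2 : ℝ) ^ Rc - 1), p g)
        + ∫ g in Ioi 0, gaussDev (Real.sqrt N * margin ((2 : ℝ) ^ Rc - 1) g) * p g := by
  set x₀ := (2 : ℝ) ^ Rc - 1
  have hx₀ : 0 < x₀ := sub_pos.2 (Real.one_lt_rpow (by norm_num) hRc)
  have hs : 0 < Real.sqrt N := Real.sqrt_pos.2 (by exact_mod_cast hN)
  have hD : IntegrableOn (fun g => gaussDev (Real.sqrt N * margin x₀ g) * p g) (Ioi 0) :=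
    hp.bdd_mul (measurable_gaussDev.comp
      ((measurable_margin x₀).const_mul _)).aestronglyMeasurable
      (ae_of_all _ fun x => abs_gaussDev_le_one _)
  have hI : IntegrableOn ((Ioc 0 x₀).indicator p) (Ioi 0) := hp.indicator measurableSet_Ioc
  have hcap : ∫ g in Ioc 0 x₀, p g = ∫ g in Ioi 0, (Ioc 0 x₀).indicator p g := by
    rw [setIntegral_indicator measurableSet_Ioc, inter_eq_right.2 Ioc_subset_Ioi_self]
  rw [hcap, ← integral_add hI hD]
  refine integral_congr_ae ?_
  filter_upwards [ae_restrict_mem measurableSet_Ioi,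
    ae_restrict_of_ae (Measure.ae_ne volume x₀)] with g hg hne
  have hg : 0 < g := hg
  rw [packetLoss_eq N Rc hg, gaussDev]
  rcases lt_or_gt_of_ne hne with h | h
  · rw [indicator_of_mem (show g ∈ Ioc 0 x₀ from ⟨hg, h.le⟩),
      Real.sign_of_neg (mul_neg_of_pos_of_neg hs ((margin_neg_iff hx₀ hg).2 h))]
    ring
  · rw [indicator_of_notMem (fun hm => absurd hm.2 (not_le.2 h)),
      Real.sign_of_pos (mul_pos hs ((margin_pos_iff hx₀ hg).2 h))]
    ring

lemma integral_Ioi_erlangPDF {L : ℕ} (hL : 1 ≤ L) {g : ℝ} (hg : 0 < g) (x : ℝ) :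
    ∫ y in Ioi x, erlangPDF L g y = 1 / Real.Gamma L * upperGamma L (1 / g * x) := by
  have h := integral_comp_mul_left_Ioi
    (fun t : ℝ => t ^ ((L : ℝ) - 1) * Real.exp (-t)) x (b := 1 / g) (by positivity)
  rw [upperGamma]
  rw [one_div, inv_inv, smul_eq_mul, ← one_div] at h
  have hG : 0 < Real.Gamma L := Real.Gamma_pos_of_pos (by exact_mod_cast hL)
  have h2 : ∀ y, erlangPDF L g y = (1 / (g * Real.Gamma L)) *
      ((1 / g * y) ^ ((L : ℝ) - 1) * Real.exp (-(1 / g * y))) := fun y => by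
    rw [← Nat.cast_one, ← Nat.cast_sub hL, Real.rpow_natCast, Nat.cast_one, erlangPDF,
      show y / g = 1 / g * y by ring]
    ring
  simp_rw [h2]
  rw [integral_const_mul, h]
  field_simp

lemma upperGamma_zero {L : ℕ} (hL : 1 ≤ L) : upperGamma L 0 = Real.Gamma L := by
  rw [upperGamma, Real.Gamma_eq_integral (by exact_mod_cast hL)]
  simp_rw [mul_comm]

lemma integral_Ioc_erlangPDF {L : ℕ} (hL : 1 ≤ L) {g : ℝ} (hg : 0 < g) {x : ℝ} (hx : 0 ≤ x) :
    ∫ y in Ioc 0 x, erlangPDF L g y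
      = 1 - 1 / Real.Gamma L * upperGamma L (1 / g * x) := by
  have hi := integrableOn_erlangPDF hL hg
  have hG : 0 < Real.Gamma L := Real.Gamma_pos_of_pos (by exact_mod_cast hL)
  have h := setIntegral_union (Ioc_disjoint_Ioi (a := 0) (le_refl x)) measurableSet_Ioi
    (hi.mono_set Ioc_subset_Ioi_self) (hi.mono_set (Ioi_subset_Ioi hx))
  rw [Ioc_union_Ioi_eq_Ioi hx, integral_Ioi_erlangPDF hL hg, integral_Ioi_erlangPDF hL hg,
    mul_zero, upperGamma_zero hL, one_div, inv_mul_cancel₀ hG.ne', ← one_div] at h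
  linarith

/-- Permits division by the main term, turning the additive error into a relative one. -/
lemma integral_Ioc_erlangPDF_pos {L : ℕ} (hL : 1 ≤ L) {g : ℝ} (hg : 0 < g) {x : ℝ} (hx : 0 < x) :
    0 < ∫ y in Ioc 0 x, erlangPDF L g y := by
  rw [← intervalIntegral.integral_of_le hx.le]
  exact intervalIntegral.intervalIntegral_pos_of_pos_on
    ((contDiff_erlangPDF L g).continuous.intervalIntegrable _ _)
    (fun y hy => erlangPDF_pos hL hg hy.1) hx

lemma exists_isBigO_avgPacketLoss {L : ℕ} (hL : 1 ≤ L) {g Rc : ℝ} (hg : 0 < g) (hRc : 0 < Rc) :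
    ∃ δ : ℕ → ℝ, δ =O[atTop] (fun N : ℕ => 1 / (N : ℝ)) ∧ ∀ N : ℕ, 1 ≤ N →
      avgPacketLoss L g Rc N
        = (1 - 1 / Real.Gamma L * upperGamma L (1 / g * ((2 : ℝ) ^ Rc - 1))) * (1 + δ N) := by
  have hx₀ : 0 < (2 : ℝ) ^ Rc - 1 := sub_pos.2 (Real.one_lt_rpow (by norm_num) hRc)
  have hp := integrableOn_erlangPDF hL hg
  rw [← integral_Ioc_erlangPDF hL hg hx₀.le]
  have hq := integral_Ioc_erlangPDF_pos hL hg hx₀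
  have hdec := fun (N : ℕ) (hN : 1 ≤ N) => integral_packetLoss_mul hp hN hRc
  set x₀ := (2 : ℝ) ^ Rc - 1
  set q := ∫ y in Ioc 0 x₀, erlangPDF L g y
  obtain ⟨K, hK⟩ := exists_abs_integral_gaussDev_le hx₀ (measurable_margin x₀)
    (contDiffAt_margin hx₀) (margin_self x₀) (deriv_margin_pos hx₀) (exists_le_abs_margin hx₀) hp
    (fun x hx => erlangPDF_nonneg hL hg hx.le)
    ((contDiff_erlangPDF L g).differentiable (by simp) x₀)
  -- `δ` is the exact error divided by the main term; the bound `K / s²` at `s = √N` makes it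
  -- `O(1/N)`.
  refine ⟨fun N => (∫ x in Ioi 0, gaussDev (Real.sqrt N * margin x₀ x) * erlangPDF L g x) / q,
    IsBigO.of_bound (K / q) ?_, fun N hN => ?_⟩
  · filter_upwards [eventually_ge_atTop 1] with N hN
    have hN0 : (0 : ℝ) < N := by exact_mod_cast hN
    have h := hK (Real.sqrt N) (Real.sqrt_pos.2 hN0)
    rw [Real.sq_sqrt hN0.le] at h
    rw [norm_div, Real.norm_eq_abs, Real.norm_of_nonneg hq.le,
      Real.norm_of_nonneg (by positivity), div_mul_div_comm, mul_one, mul_comm q, ← div_div]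
    gcongr
  · rw [avgPacketLoss, hdec N hN]
    field_simp

end ShortPacket

theorem proposition1 {Ω : Type*} [MeasurableSpace Ω] (P : Measure Ω) [IsProbabilityMeasure P]
    (L : ℕ) (hL : 1 ≤ L) (P₀ N₀ γ₀ Rc : ℝ) (hP₀ : 0 < P₀) (hN₀ : 0 < N₀) (hγ₀ : γ₀ = P₀ / N₀)
    (hRc : 0 < Rc) (h : Fin L → Ω → ℂ) (hindep : iIndepFun h P)
    (hlaw : ∀ l, HasLaw (h l) ShortPacket.stdComplexGaussian P) :
    -- the SNR after maximal ratio combining is `γ₀ ‖h‖²` and has the law Erlang(L, 1/γ₀)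
    (∀ ω, ShortPacket.mrcSNR P₀ N₀ (fun l => h l ω) = γ₀ * ∑ l, ‖h l ω‖ ^ 2) ∧
    HasLaw (fun ω => ShortPacket.mrcSNR P₀ N₀ (fun l => h l ω))
      ((volume.restrict (Ioi (0 : ℝ))).withDensity
        (fun γ => ENNReal.ofReal (ShortPacket.erlangPDF L γ₀ γ))) P ∧
    -- the average packet loss probability is the integral against the Erlang density
    (∀ N : ℕ,
      Integrable (fun ω => ShortPacket.packetLoss N Rc
        (ShortPacket.mrcSNR P₀ N₀ (fun l => h l ω))) P ∧
      IntegrableOn (fun γ => ShortPacket.packetLoss N Rc γ * ShortPacket.erlangPDF L γ₀ γ)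
        (Ioi (0 : ℝ)) ∧
      ∫ ω, ShortPacket.packetLoss N Rc (ShortPacket.mrcSNR P₀ N₀ (fun l => h l ω)) ∂P
        = ShortPacket.avgPacketLoss L γ₀ Rc N) ∧
    -- its value up to a relative error `O(1/N)`
    ∃ δ : ℕ → ℝ, δ =O[atTop] (fun N : ℕ => 1 / (N : ℝ)) ∧
      ∀ N : ℕ, 1 ≤ N →
        ShortPacket.avgPacketLoss L γ₀ Rc N
          = (1 - 1 / Real.Gamma L
              * ShortPacket.upperGamma L (1 / γ₀ * ((2 : ℝ) ^ Rc - 1))) * (1 + δ N) := by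
  have hg : 0 < γ₀ := hγ₀ ▸ div_pos hP₀ hN₀
  have hsnr : ∀ ω, ShortPacket.mrcSNR P₀ N₀ (fun l => h l ω) = γ₀ * ∑ l, ‖h l ω‖ ^ 2 :=
    fun ω => hγ₀ ▸ ShortPacket.mrcSNR_eq P₀ N₀ _
  have hsnrlaw : HasLaw (fun ω => ShortPacket.mrcSNR P₀ N₀ (fun l => h l ω))
      (ShortPacket.erlangMeasure L γ₀) P := by
    simp_rw [hsnr]
    exact ShortPacket.hasLaw_sum_normSq hL hg hindep hlaw
  refine ⟨hsnr, hsnrlaw, fun N => ⟨?_, ?_, ?_⟩,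
    ShortPacket.exists_isBigO_avgPacketLoss hL hg hRc⟩
  · exact Integrable.of_bound ((ShortPacket.measurable_packetLoss N Rc).comp_aemeasurable
      hsnrlaw.aemeasurable).aestronglyMeasurable 1
      (ae_of_all _ fun ω => ShortPacket.abs_packetLoss_le_one N Rc _)
  · exact ShortPacket.integrableOn_packetLoss_mul (ShortPacket.integrableOn_erlangPDF hL hg) N Rc
  · refine (hsnrlaw.integral_comp
      (ShortPacket.measurable_packetLoss N Rc).aestronglyMeasurable).trans ?_
    rw [ShortPacket.integral_erlangMeasure hL hg, ShortPacket.avgPacketLoss]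
    simp_rw [smul_eq_mul, mul_comm]
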